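/- **Definitions.** A *convex combination (CC) space* is a metric space $(\mathfrak X,d)$ with an operation assigning to all $n\ge 1$, $\lambda_1,\dots,\lambda_n>0$ with $\sum_i\lambda_i=1$ and $u_1,\dots,u_n\in\mathfrak X$ an element $[\lambda_i,u_i]_{i=1}^n\in\mathfrak X$, such that $[1,u]=u$ and: (i) $[\lambda_i,u_i]_{i=1}^n=[\lambda_{\sigma(i)},u_{\sigma(i)}]_{i=1}^n$ for every permutation $\sigma$; (ii) $[\lambda_i,u_i]_{i=1}^{n+2}=\big[\lambda_1,u_1;\dots;\lambda_n,u_n;\lambda_{n+1}+\lambda_{n+2},\big[\tfrac{\lambda_{n+j}}{\lambda_{n+1}+\lambda_{n+2}},u_{n+j}\big]_{j=1}^2\big]$; (iii) if $\lambda^{(k)}\to\lambda$ in $(0,1)$, then $[\lambda^{(k)},u;1-\lambda^{(k)},v]\to[\lambda,u;1-\lambda,v]$; (iv) $d([\lambda,u_1;1-\lambda,u_2],[\lambda,v_1;1-\lambda,v_2])\le\lambda d(u_1,v_1)+(1-\lambda)d(u_2,v_2)$ for $\lambda\in(0,1)$; (v) for each $u$ the limit $Ku:=\lim_{n\to\infty}[n^{-1},u]_{i=1}^n$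 exists. Put $K(\mathfrak X)=\{Ku:u\in\mathfrak X\}$ (the set of convex points). Terms of weight $0$ in a convex combination are dropped; thus $[I_A,X;I_{A^c},a]$ equals $X$ on $A$ and $a$ on $A^c$. Let $\mathfrak X$ be a complete separable CC space, $(\Omega,\mathcal F,P)$ a probability space and $\mathcal G\subset\mathcal F$ a sub-$\sigma$-algebra. For $C\subset\mathfrak X$, $L^1_C(\mathcal G)$ is the set of ($P$-a.s. equivalence classes of) $\mathcal G$-measurable $Y:\Omega\to C$ with $E\,d(c,Y)<\infty$ for some $c\in\mathfrak X$; $L^1_{\mathfrak X}=L^1_{\mathfrak X}(\mathcal F)$. Fix $u_0\in K(\mathfrak X)$ and a sequence $(u_j)_{j\ge1}$ dense in $\mathfrak X$, and let $\psi_n(x)=u_i$ for the smallest $i\in\{0,\dots,n\}$ with $d(u_i,x)=\min_{0\le j\le n}d(u_j,x)$. For a random element $S$ with finitely many values $x_1,\dots,x_m$ put $ES=[P(S=x_i),Kx_i]_{i=1}^m$ and $E(S|\mathcal G)=[P(S=x_i|\mathcal G),Kx_i]_{i=1}^m$ (a.s.). For $X\in L^1_{\mathfrak X}$ put $EX=\lim_nE\psi_n(X)$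 and $E(X|\mathcal G)=\lim_nE(\psi_n(X)|\mathcal G)$ a.s. **Theorem.** Let $X\in L^1_{\mathfrak X}$ and $a\in K(\mathfrak X)$. Then $E(X|\mathcal G)$ exists (the a.s. limit exists), and for every $Y:\Omega\to\mathfrak X$, $Y=E(X|\mathcal G)$ a.s. if and only if $Y\in L^1_{K(\mathfrak X)}(\mathcal G)$ and, for all $A\in\mathcal G$, the expectations $E[I_A,X;I_{A^c},a]$ and $E[I_A,Y;I_{A^c},a]$ exist and $$E[I_A,X;I_{A^c},a]=E[I_A,Y;I_{A^c},a].$$ -/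

import Mathlib

open MeasureTheory Filter Topology

/-- A convex combination space: a metric space with an operation
`comb w x = [w₁, x₁; …; wₙ, xₙ]`, meaningful for strictly positive weights `w` of sum one
(the values of `comb` at other weights are irrelevant and are constrained by nothing). -/
class CCSpace (X : Type*) [MetricSpace X] where
  /-- The convex combination operation. -/
  comb : {n : ℕ} → (Fin n → ℝ) → (Fin n → X) → X
  /-- `[1, u] = u`. -/
  comb_one : ∀ u : X, comb (fun _ : Fin 1 => (1 : ℝ)) (fun _ => u) = u
  /-- Commutativity. -/
  comb_perm : ∀ {n : ℕ} (w : Fin n → ℝ) (x : Fin n → X) (σ : Equiv.Perm (Fin n)),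
    (∀ i, 0 < w i) → ∑ i, w i = 1 → comb w x = comb (w ∘ σ) (x ∘ σ)
  /-- Associativity. -/
  comb_assoc : ∀ {n : ℕ} (w : Fin n → ℝ) (x : Fin n → X) (a b : ℝ) (u v : X),
    (∀ i, 0 < w i) → 0 < a → 0 < b → ∑ i, w i + a + b = 1 →
    comb (Fin.append w ![a, b]) (Fin.append x ![u, v]) =
      comb (Fin.append w ![a + b]) (Fin.append x ![comb ![a / (a + b), b / (a + b)] ![u, v]])
  /-- Continuity in the weight. -/
  comb_tendsto : ∀ (u v : X) (l : ℕ → ℝ) (t : ℝ),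
    (∀ k, 0 < l k ∧ l k < 1) → 0 < t → t < 1 → Tendsto l atTop (𝓝 t) →
    Tendsto (fun k => comb ![l k, 1 - l k] ![u, v]) atTop (𝓝 (comb ![t, 1 - t] ![u, v]))
  /-- Negative curvature. -/
  dist_comb_le : ∀ (u₁ u₂ v₁ v₂ : X) (t : ℝ), 0 < t → t < 1 →
    dist (comb ![t, 1 - t] ![u₁, u₂]) (comb ![t, 1 - t] ![v₁, v₂]) ≤
      t * dist u₁ v₁ + (1 - t) * dist u₂ v₂
  /-- Convexification: `[1/n, u; …; 1/n, u]` (`n` terms) converges as `n → ∞`. -/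
  exists_convexify : ∀ u : X, ∃ l : X,
    Tendsto (fun n : ℕ => comb (fun _ : Fin (n + 1) => 1 / ((n : ℝ) + 1)) (fun _ => u))
      atTop (𝓝 l)

namespace CCSpace

section Operations

variable {X : Type*} [MetricSpace X] [CCSpace X]

/-- The convexification operator `K u = lim [1/n, u; …; 1/n, u]`. -/
noncomputable def K (u : X) : X := Classical.choose (exists_convexify u)

variable (X) in
/-- The convexifiable domain `K(X)`. -/
def convexDomain : Set X := Set.range (K : X → X)

/-- `[w i, x i]` over `i ∈ V` for nonnegative weights of sum one: the terms of weight zero are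
dropped. By commutativity the enumeration of the remaining terms does not matter. -/
noncomputable def combOn {ι : Type*} (V : Finset ι) (w : ι → ℝ) (x : ι → X) : X :=
  comb (fun k => w ((V.filter (fun i => 0 < w i)).equivFin.symm k))
    (fun k => x ((V.filter (fun i => 0 < w i)).equivFin.symm k))

/-- The least index `i ≤ n` for which `u i` is a point of `{u 0, …, u n}` nearest to `x`. -/
noncomputable def nearestIndex (u : ℕ → X) (n : ℕ) (x : X) : ℕ :=
  sInf {i : ℕ | i ≤ n ∧ ∀ j ≤ n, dist (u i) x ≤ dist (u j) x}

/-- The finitely-valued approximation `ψ_n : X → {u 0, …, u n}` of the identity. -/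
noncomputable def approx (u : ℕ → X) (n : ℕ) (x : X) : X := u (nearestIndex u n x)

open Classical in
/-- The finite set `{u 0, …, u n}`. -/
noncomputable def firstPoints (u : ℕ → X) (n : ℕ) : Finset X :=
  (Finset.range (n + 1)).image u

end Operations

section Probability

variable {Ω X : Type*} [MetricSpace X] [CCSpace X]

/-- The expectation `[P(S = x), K x]` over `x ∈ V` of a simple random element `S` whose values
lie in the finite set `V`. -/
noncomputable def simpleExp {mΩ : MeasurableSpace Ω} (P : Measure Ω) (V : Finset X)
    (S : Ω → X) : X :=
  combOn V (fun x => P.real (S ⁻¹' {x})) K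

/-- The conditional expectation `[P(S = x | G), K x]` over `x ∈ V` of a simple random element `S`
whose values lie in the finite set `V`. -/
noncomputable def simpleCondExp {mΩ : MeasurableSpace Ω} (P : Measure Ω) (G : MeasurableSpace Ω)
    (V : Finset X) (S : Ω → X) (ω : Ω) : X :=
  combOn V (fun x => (P[(S ⁻¹' {x}).indicator (fun _ => (1 : ℝ)) | G]) ω) K

/-- `e` is the expectation of `Z`: the limit of the expectations of the simple random elements
`ψ_n(Z)`. -/
def HasExp {mΩ : MeasurableSpace Ω} (P : Measure Ω) (u : ℕ → X) (Z : Ω → X) (e : X) : Prop :=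
  Tendsto (fun n => simpleExp P (firstPoints u n) (approx u n ∘ Z)) atTop (𝓝 e)

/-- `Y` is (a version of) the conditional expectation of `Z` given `G`: the almost sure limit of
the conditional expectations of the simple random elements `ψ_n(Z)`. -/
def IsCondExp {mΩ : MeasurableSpace Ω} (P : Measure Ω) (G : MeasurableSpace Ω) (u : ℕ → X)
    (Z Y : Ω → X) : Prop :=
  ∀ᵐ ω ∂P, Tendsto (fun n => simpleCondExp P G (firstPoints u n) (approx u n ∘ Z) ω) atTop
    (𝓝 (Y ω))

/-- `Y` represents an element of `L¹_C(G)`, the space of classes, modulo almost sure equality, of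
`G`-measurable integrable random elements with values in `C`. -/
def MemL1 [MeasurableSpace X] {mΩ : MeasurableSpace Ω} (P : Measure Ω) (G : MeasurableSpace Ω)
    (C : Set X) (Y : Ω → X) : Prop :=
  ∃ Y' : Ω → X, Measurable[G] Y' ∧ (∀ ω, Y' ω ∈ C) ∧
    (∃ c : X, Integrable (fun ω => dist c (Y' ω)) P) ∧ Y =ᵐ[P] Y'

/-- The random element `[I_A, Z; I_{Aᶜ}, a]`. -/
noncomputable def mix (A : Set Ω) (Z : Ω → X) (a : X) (ω : Ω) : X :=
  combOn Finset.univ ![A.indicator (fun _ => (1 : ℝ)) ω, Aᶜ.indicator (fun _ => (1 : ℝ)) ω]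
    ![Z ω, a]

end Probability

end CCSpace

/-! The proof moves the problem into a Banach space. There is an affine map `φ : X → E` with `dist
(φ x) (φ y) = dist (K x) (K y)` (`exists_embedding`): it does not distinguish `x` from `K x`, and it
is isometric on the convex points. Simple conditional expectations are combinations of convex
points, so `φ` sends them to Bochner conditional expectations (`ae_simpleCondExp`). This survives
the limit, because the error is at most the conditional expectation of the distance from `ψ_n(Z)` to
`Z`, which decreases to zero (`ae_tendsto_simpleCondExp`). Hence `isCondExp_iff`: `Y` is a version
of the conditional expectation exactly when it is a.s. convex and `φ ∘ Y = P[φ ∘ Z | G]` a.s.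
Completeness of `X` gives existence. The theorem becomes the characterization of a Bochner
conditional expectation by its integrals over the sets `A` of `G`; the contribution of `a` on `Aᶜ`
is common to both sides and cancels.

To build `φ`, points are given masses. The axioms make the resulting cone a commutative monoid, in
which mass times distance is subadditive. On convex points this quantity is even translation
invariant (`gap_coneK_add_right`), so it extends to a seminorm on formal real combinations of
points, and `E` is the completion. -/

namespace CCSpace

/-! ### The cone of points with masses -/

/-- A point of `X` with a positive mass. -/
@[ext]
structure Atom (X : Type*) where
  /-- The mass. -/
  mass : ℝ
  pos : 0 < mass
  /-- The point carrying the mass. -/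
  pt : X

variable {X : Type*}

/-- The cone over `X`. -/
abbrev Cone (X : Type*) := WithZero (Atom X)

/-- The point `x` with mass `r`, which is zero unless `r` is positive. -/
noncomputable def dirac (r : ℝ) (x : X) : Cone X :=
  if h : 0 < r then ((⟨r, h, x⟩ : Atom X) : Cone X) else 0

theorem dirac_of_pos {r : ℝ} (h : 0 < r) (x : X) :
    dirac r x = ((⟨r, h, x⟩ : Atom X) : Cone X) := dif_pos h

theorem dirac_of_nonpos {r : ℝ} (h : r ≤ 0) (x : X) : dirac r x = 0 := dif_neg h.not_gt

@[simp]
theorem dirac_zero (x : X) : dirac 0 x = 0 := dirac_of_nonpos le_rfl x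

theorem dirac_injective {r : ℝ} (hr : 0 < r) : Function.Injective (dirac r : X → Cone X) := by
  intro x y h
  rw [dirac_of_pos hr, dirac_of_pos hr, WithZero.coe_inj] at h
  exact congrArg Atom.pt h

theorem exists_eq_dirac (a : Cone X) (h : a ≠ 0) : ∃ r x, 0 < r ∧ a = dirac r x := by
  obtain ⟨p, rfl⟩ := WithZero.ne_zero_iff_exists.1 h
  exact ⟨p.mass, p.pt, p.pos, (dirac_of_pos p.pos p.pt).symm⟩

theorem append_one_two {α : Type*} (a b c : α) :
    (Fin.append ![a] ![b, c] : Fin 3 → α) = ![a, b, c] := by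
  ext i
  fin_cases i <;> rfl

theorem append_one_one {α : Type*} (a b : α) :
    (Fin.append ![a] ![b] : Fin 2 → α) = ![a, b] := by
  ext i
  fin_cases i <;> rfl

section Cone

variable [MetricSpace X] [CCSpace X]

theorem comb_two_comm (a b : ℝ) (x y : X) (ha : 0 < a) (hb : 0 < b) (hab : a + b = 1) :
    comb ![a, b] ![x, y] = comb ![b, a] ![y, x] := by
  have h := comb_perm ![a, b] ![x, y] (Equiv.swap 0 1)
    (by intro i; fin_cases i <;> simpa) (by simpa [Fin.sum_univ_two])
  rw [h]
  congr 1 <;> (ext i; fin_cases i <;> simp)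

theorem comb_three (a b c : ℝ) (x y z : X) (ha : 0 < a) (hb : 0 < b) (hc : 0 < c)
    (h : a + b + c = 1) :
    comb ![a, b, c] ![x, y, z] =
      comb ![a, b + c] ![x, comb ![b / (b + c), c / (b + c)] ![y, z]] := by
  have key := comb_assoc ![a] ![x] b c y z (by intro i; fin_cases i; simpa) hb hc (by simpa)
  rw [← append_one_two a b c, ← append_one_two x y z, ← append_one_one a (b + c),
    ← append_one_one x (comb _ _)]
  exact key

/-- The axiom merges the last two points only; a cyclic permutation merges the first two. Comparing
both forms gives associativity of `Atom` addition. -/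
theorem comb_three' (a b c : ℝ) (x y z : X) (ha : 0 < a) (hb : 0 < b) (hc : 0 < c)
    (h : a + b + c = 1) :
    comb ![a, b, c] ![x, y, z] =
      comb ![a + b, c] ![comb ![a / (a + b), b / (a + b)] ![x, y], z] := by
  rw [comb_two_comm (a + b) c _ _ (by positivity) hc h,
    ← comb_three c a b z x y hc ha hb (by linarith)]
  rw [comb_perm ![a, b, c] ![x, y, z] (finRotate 3).symm
    (by intro i; fin_cases i <;> simpa) (by simpa [Fin.sum_univ_three])]
  congr 1 <;> (ext i; fin_cases i <;> rfl)

/-- Masses add up, and the points are combined in proportion to their masses. -/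
noncomputable instance : Add (Atom X) where
  add p q := ⟨p.mass + q.mass, add_pos p.pos q.pos,
    comb ![p.mass / (p.mass + q.mass), q.mass / (p.mass + q.mass)] ![p.pt, q.pt]⟩

theorem Atom.mass_add (p q : Atom X) : (p + q).mass = p.mass + q.mass := rfl

theorem Atom.pt_add (p q : Atom X) : (p + q).pt =
    comb ![p.mass / (p.mass + q.mass), q.mass / (p.mass + q.mass)] ![p.pt, q.pt] := rfl

noncomputable instance : AddCommSemigroup (Atom X) where
  add_assoc p q r := by
    have hp := p.pos
    have hq := q.pos
    have hr := r.pos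
    ext
    · simp only [Atom.mass_add]; ring
    · have h1 := comb_three (p.mass / (p.mass + q.mass + r.mass))
        (q.mass / (p.mass + q.mass + r.mass)) (r.mass / (p.mass + q.mass + r.mass))
        p.pt q.pt r.pt (by positivity) (by positivity) (by positivity) (by field_simp)
      rw [comb_three' _ _ _ _ _ _ (by positivity) (by positivity) (by positivity)
        (by field_simp)] at h1
      simp only [Atom.pt_add, Atom.mass_add]
      convert h1 using 4 <;> (try field_simp) <;> (try ring_nf)
  add_comm p q := by
    have hp := p.pos
    have hq := q.pos
    ext
    · simp only [Atom.mass_add]; ring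
    · simp only [Atom.pt_add]
      rw [comb_two_comm _ _ _ _ (by positivity) (by positivity) (by field_simp), add_comm q.mass]

theorem dirac_add_dirac {r s : ℝ} (hr : 0 < r) (hs : 0 < s) (x y : X) :
    dirac r x + dirac s y = dirac (r + s) (comb ![r / (r + s), s / (r + s)] ![x, y]) := by
  rw [dirac_of_pos hr, dirac_of_pos hs, dirac_of_pos (add_pos hr hs)]
  rfl

/-- Induction on the number of points, merging the last two by `comb_assoc`. Afterwards every
identity between convex combinations is a computation in a commutative monoid. -/
theorem sum_dirac : ∀ {n : ℕ} (w : Fin (n + 1) → ℝ) (x : Fin (n + 1) → X),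
    (∀ i, 0 < w i) → ∑ i, w i = 1 → ∑ i, dirac (w i) (x i) = dirac 1 (comb w x) := by
  intro n
  induction n with
  | zero =>
    intro w x hw h
    have h0 : w = fun _ => 1 := by
      ext i
      fin_cases i
      simpa using h
    have h1 : x = fun _ => x 0 := by
      ext i
      fin_cases i
      rfl
    rw [h0, h1, comb_one]
    simp
  | succ n ih =>
    intro w x hw h
    set w' : Fin n → ℝ := fun i => w (Fin.castAdd 2 i) with hw'
    set x' : Fin n → X := fun i => x (Fin.castAdd 2 i) with hx'
    set a := w (Fin.natAdd n (0 : Fin 2))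
    set b := w (Fin.natAdd n (1 : Fin 2))
    set y := x (Fin.natAdd n (0 : Fin 2))
    set z := x (Fin.natAdd n (1 : Fin 2))
    have ha : 0 < a := hw _
    have hb : 0 < b := hw _
    have ew : w = Fin.append w' ![a, b] := by
      rw [← Fin.append_castAdd_natAdd (m := n) (n := 2) (f := w)]
      congr 1
      ext i
      fin_cases i <;> rfl
    have ex : x = Fin.append x' ![y, z] := by
      rw [← Fin.append_castAdd_natAdd (m := n) (n := 2) (f := x)]
      congr 1
      ext i
      fin_cases i <;> rfl
    have hsum : ∑ i, w' i + a + b = 1 := by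
      rw [← h, Fin.sum_univ_add (a := n) (b := 2), Fin.sum_univ_two]
      simp only [hw', a, b]
      ring
    have key := ih (Fin.append w' ![a + b])
      (Fin.append x' ![comb ![a / (a + b), b / (a + b)] ![y, z]])
      (by
        intro i
        refine Fin.addCases (fun i => ?_) (fun i => ?_) i
        · rw [Fin.append_left]; exact hw _
        · rw [Fin.append_right]; fin_cases i; simpa using add_pos ha hb)
      (by
        rw [Fin.sum_univ_add (a := n) (b := 1)]
        simp only [Fin.append_left, Fin.append_right]
        simp only [Fin.sum_univ_one, Matrix.cons_val_fin_one]
        linarith)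
    rw [Fin.sum_univ_add (a := n) (b := 1)] at key
    simp only [Fin.append_left, Fin.append_right] at key
    simp only [Fin.sum_univ_one, Matrix.cons_val_fin_one] at key
    rw [ew, ex, comb_assoc w' x' a b y z (fun i => hw _) ha hb hsum, ← key,
      Fin.sum_univ_add (a := n) (b := 2)]
    simp only [Fin.append_left, Fin.append_right]
    simp [Fin.sum_univ_two, dirac_add_dirac ha hb]

/-- Multiplication of the masses by a positive number. -/
noncomputable def scale (c : ℝ) (hc : 0 < c) : Cone X →+ Cone X :=
  WithZero.mapAddHom
    { toFun := fun p : Atom X => (⟨c * p.mass, mul_pos hc p.pos, p.pt⟩ : Atom X)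
      map_add' := by
        intro p q
        have hp := p.pos
        have hq := q.pos
        ext
        · simp only [Atom.mass_add]; ring
        · simp only [Atom.pt_add]
          congr 2
          · field_simp
          · congr 1; field_simp }

@[simp]
theorem scale_dirac {c : ℝ} (hc : 0 < c) (r : ℝ) (x : X) :
    scale c hc (dirac r x) = dirac (c * r) x := by
  rcases lt_or_ge 0 r with h | h
  · rw [dirac_of_pos h, dirac_of_pos (mul_pos hc h)]; rfl
  · rw [dirac_of_nonpos h, dirac_of_nonpos (mul_nonpos_of_nonneg_of_nonpos hc.le h), map_zero]

/-- The total mass. -/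
noncomputable def mass : Cone X →+ ℝ :=
  WithZero.lift { toFun := fun p : Atom X => p.mass, map_add' := fun _ _ => rfl }

theorem mass_dirac {r : ℝ} (hr : 0 ≤ r) (x : X) : mass (dirac r x) = r := by
  rcases hr.lt_or_eq with h | rfl
  · rw [dirac_of_pos h]; rfl
  · simp

theorem mass_nonneg (a : Cone X) : 0 ≤ mass a := by
  by_cases h : a = 0
  · simp [h]
  · obtain ⟨r, x, hr, rfl⟩ := exists_eq_dirac a h
    rw [mass_dirac hr.le]; exact hr.le

theorem eq_zero_of_mass {a : Cone X} (h : mass a = 0) : a = 0 := by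
  by_contra h0
  obtain ⟨r, x, hr, rfl⟩ := exists_eq_dirac a h0
  rw [mass_dirac hr.le] at h
  exact hr.ne' h

theorem mass_scale {c : ℝ} (hc : 0 < c) (a : Cone X) : mass (scale c hc a) = c * mass a := by
  by_cases h : a = 0
  · simp [h]
  · obtain ⟨r, x, hr, rfl⟩ := exists_eq_dirac a h
    rw [scale_dirac, mass_dirac hr.le, mass_dirac (by positivity)]

end Cone

end CCSpace

namespace CCSpace

/-! ### Mass-weighted distance, convexification and cancellation -/

section Gap

variable {X : Type*} [MetricSpace X]

/-- The mass times the distance of the points, for two cone elements of the same mass. -/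
noncomputable def gap (a b : Cone X) : ℝ :=
  WithZero.recZeroCoe (motive := fun _ => ℝ) 0
    (fun p => WithZero.recZeroCoe (motive := fun _ => ℝ) 0
      (fun q => p.mass * dist p.pt q.pt) b) a

theorem gap_dirac {r : ℝ} (hr : 0 ≤ r) (x y : X) :
    gap (dirac r x) (dirac r y) = r * dist x y := by
  rcases hr.lt_or_eq with h | rfl
  · rw [dirac_of_pos h, dirac_of_pos h]; rfl
  · rw [dirac_zero, dirac_zero, zero_mul]; rfl

theorem gap_zero : gap (0 : Cone X) 0 = 0 := rfl

theorem gap_self (a : Cone X) : gap a a = 0 := by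
  by_cases h : a = 0
  · rw [h, gap_zero]
  · obtain ⟨r, x, hr, rfl⟩ := exists_eq_dirac a h
    rw [gap_dirac hr.le, dist_self, mul_zero]

variable [CCSpace X]

theorem dist_comb_two_le {a b : ℝ} (ha : 0 < a) (hb : 0 < b) (hab : a + b = 1) (u v u' v' : X) :
    dist (comb ![a, b] ![u, v]) (comb ![a, b] ![u', v']) ≤ a * dist u u' + b * dist v v' := by
  obtain rfl : b = 1 - a := by linarith
  exact dist_comb_le u v u' v' a ha (by linarith)

theorem exists_dirac_of_mass_eq {a b : Cone X} (h : mass a = mass b) (ha : a ≠ 0) :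
    ∃ r x y, 0 < r ∧ a = dirac r x ∧ b = dirac r y := by
  obtain ⟨r, x, hr, rfl⟩ := exists_eq_dirac a ha
  rw [mass_dirac hr.le] at h
  obtain ⟨s, y, hs, rfl⟩ := exists_eq_dirac b (by rintro rfl; simp at h; exact hr.ne' h)
  rw [mass_dirac hs.le] at h
  subst h
  exact ⟨r, x, y, hr, rfl, rfl⟩

theorem gap_comm {a b : Cone X} (h : mass a = mass b) : gap a b = gap b a := by
  by_cases ha : a = 0
  · subst ha
    rw [eq_zero_of_mass (a := b) (by rw [← h, map_zero])]
  · obtain ⟨r, x, y, hr, rfl, rfl⟩ := exists_dirac_of_mass_eq h ha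
    rw [gap_dirac hr.le, gap_dirac hr.le, dist_comm]

theorem gap_triangle {a b c : Cone X} (h : mass a = mass b) (h' : mass b = mass c) :
    gap a c ≤ gap a b + gap b c := by
  by_cases ha : a = 0
  · subst ha
    have hb := eq_zero_of_mass (a := b) (by rw [← h, map_zero])
    have hc := eq_zero_of_mass (a := c) (by rw [← h', ← h, map_zero])
    rw [hb, hc, gap_zero, add_zero]
  · obtain ⟨r, x, y, hr, rfl, rfl⟩ := exists_dirac_of_mass_eq h ha
    obtain ⟨s, z, hs, rfl⟩ := exists_eq_dirac c (by
      rintro rfl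
      rw [mass_dirac hr.le, map_zero] at h'
      exact hr.ne' h')
    rw [mass_dirac hr.le, mass_dirac hs.le] at h'
    subst h'
    rw [gap_dirac hr.le, gap_dirac hr.le, gap_dirac hr.le, ← mul_add]
    exact mul_le_mul_of_nonneg_left (dist_triangle _ _ _) hr.le

/-- The negative curvature axiom, made homogeneous in the masses. -/
theorem gap_add_le {a b c d : Cone X} (h : mass a = mass b) (h' : mass c = mass d) :
    gap (a + c) (b + d) ≤ gap a b + gap c d := by
  by_cases ha : a = 0
  · subst ha
    rw [eq_zero_of_mass (a := b) (by rw [← h, map_zero]), gap_zero]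
    simp
  by_cases hc : c = 0
  · subst hc
    rw [eq_zero_of_mass (a := d) (by rw [← h', map_zero]), gap_zero]
    simp
  obtain ⟨r, x, y, hr, rfl, rfl⟩ := exists_dirac_of_mass_eq h ha
  obtain ⟨s, z, w, hs, rfl, rfl⟩ := exists_dirac_of_mass_eq h' hc
  rw [dirac_add_dirac hr hs, dirac_add_dirac hr hs, gap_dirac (by positivity), gap_dirac hr.le,
    gap_dirac hs.le]
  calc (r + s) * dist (comb ![r / (r + s), s / (r + s)] ![x, z])
        (comb ![r / (r + s), s / (r + s)] ![y, w])
      ≤ (r + s) * (r / (r + s) * dist x y + s / (r + s) * dist z w) := by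
        gcongr
        exact dist_comb_two_le (by positivity) (by positivity) (by field_simp) _ _ _ _
    _ = r * dist x y + s * dist z w := by field_simp

theorem gap_add_right_le {a b : Cone X} (h : mass a = mass b) (c : Cone X) :
    gap (a + c) (b + c) ≤ gap a b := by
  simpa [gap_self] using gap_add_le h (rfl : mass c = mass c)

theorem gap_nsmul_le {a b : Cone X} (h : mass a = mass b) (n : ℕ) :
    gap (n • a) (n • b) ≤ n * gap a b := by
  induction n with
  | zero => simp [gap_zero]
  | succ n ih =>
    rw [succ_nsmul, succ_nsmul]
    have := gap_add_le (a := n • a) (b := n • b) (c := a) (d := b) (by simp [h]) h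
    push_cast
    linarith

theorem gap_scale {a b : Cone X} (h : mass a = mass b) {c : ℝ} (hc : 0 < c) :
    gap (scale c hc a) (scale c hc b) = c * gap a b := by
  by_cases ha : a = 0
  · subst ha
    rw [eq_zero_of_mass (a := b) (by rw [← h, map_zero]), map_zero, gap_zero, mul_zero]
  · obtain ⟨r, x, y, hr, rfl, rfl⟩ := exists_dirac_of_mass_eq h ha
    rw [scale_dirac, scale_dirac, gap_dirac hr.le, gap_dirac (by positivity)]
    ring

/-- `[1/(n+1), u; …; 1/(n+1), u]` with `n + 1` terms. -/
noncomputable def uniformComb (n : ℕ) (u : X) : X :=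
  comb (fun _ : Fin (n + 1) => 1 / ((n : ℝ) + 1)) (fun _ => u)

theorem tendsto_uniformComb (u : X) : Tendsto (fun n => uniformComb n u) atTop (𝓝 (K u)) :=
  Classical.choose_spec (exists_convexify u)

theorem nsmul_dirac {r : ℝ} (hr : 0 < r) (n : ℕ) (u : X) :
    (n + 1) • dirac r u = dirac ((n + 1 : ℝ) * r) (uniformComb n u) := by
  have h := sum_dirac (fun _ : Fin (n + 1) => 1 / ((n : ℝ) + 1)) (fun _ => u)
    (fun _ => by positivity) (by simp; field_simp)
  have h' := congrArg (scale ((n + 1 : ℝ) * r) (by positivity)) h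
  rw [map_sum] at h'
  simp only [scale_dirac, mul_one, Finset.sum_const, Finset.card_univ, Fintype.card_fin] at h'
  rw [show (n + 1 : ℝ) * r * (1 / (n + 1)) = r by field_simp] at h'
  exact h'

theorem dist_uniformComb_le (n : ℕ) (u v : X) :
    dist (uniformComb n u) (uniformComb n v) ≤ dist u v := by
  have h := gap_nsmul_le (a := dirac 1 u) (b := dirac 1 v)
    (by simp [mass_dirac zero_le_one]) (n + 1)
  rw [nsmul_dirac one_pos, nsmul_dirac one_pos, gap_dirac (by positivity),
    gap_dirac zero_le_one] at h
  push_cast at h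
  rw [mul_one, one_mul] at h
  exact le_of_mul_le_mul_left h (by positivity)

theorem dist_K_le (u v : X) : dist (K u) (K v) ≤ dist u v :=
  le_of_tendsto ((tendsto_uniformComb u).dist (tendsto_uniformComb v))
    (Eventually.of_forall fun n => dist_uniformComb_le n u v)

theorem continuous_K : Continuous (K : X → X) :=
  (LipschitzWith.mk_one dist_K_le).continuous

/-- Both sides are the point of `(n + 1) • (dirac a u + dirac b v)`, with the multiple taken before
or after the sum. -/
theorem uniformComb_comb_two {a b : ℝ} (ha : 0 < a) (hb : 0 < b) (hab : a + b = 1) (n : ℕ)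
    (u v : X) : uniformComb n (comb ![a, b] ![u, v]) =
      comb ![a, b] ![uniformComb n u, uniformComb n v] := by
  have e : ∀ x y : X, dirac a x + dirac b y = dirac 1 (comb ![a, b] ![x, y]) := by
    intro x y
    rw [dirac_add_dirac ha hb, hab, div_one, div_one]
  have h := nsmul_dirac one_pos n (comb ![a, b] ![u, v])
  rw [← e, nsmul_add, nsmul_dirac ha, nsmul_dirac hb, ← scale_dirac (by positivity),
    ← scale_dirac (by positivity), ← map_add, e, scale_dirac] at h
  exact (dirac_injective (by positivity) h).symm

theorem tendsto_comb_two {a b : ℝ} (ha : 0 < a) (hb : 0 < b) (hab : a + b = 1) {u v : ℕ → X}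
    {x y : X} (hu : Tendsto u atTop (𝓝 x)) (hv : Tendsto v atTop (𝓝 y)) :
    Tendsto (fun n => comb ![a, b] ![u n, v n]) atTop (𝓝 (comb ![a, b] ![x, y])) := by
  rw [tendsto_iff_dist_tendsto_zero] at hu hv ⊢
  refine squeeze_zero (fun _ => dist_nonneg) (fun n => dist_comb_two_le ha hb hab _ _ _ _) ?_
  simpa using (hu.const_mul a).add (hv.const_mul b)

theorem K_comb_two {a b : ℝ} (ha : 0 < a) (hb : 0 < b) (hab : a + b = 1) (u v : X) :
    K (comb ![a, b] ![u, v]) = comb ![a, b] ![K u, K v] := by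
  refine tendsto_nhds_unique (tendsto_uniformComb _) ?_
  simp only [uniformComb_comb_two ha hb hab]
  exact tendsto_comb_two ha hb hab (tendsto_uniformComb u) (tendsto_uniformComb v)

/-- Splitting equally weighted copies of `u` into two groups proves an approximate identity for
rational weights; continuity in the weight carries it to `t`. -/
theorem comb_two_K_self {t : ℝ} (h0 : 0 < t) (h1 : t < 1) (u : X) :
    comb ![t, 1 - t] ![K u, K u] = K u := by
  set p : ℕ → ℕ := fun n => ⌊t * n⌋₊
  set q : ℕ → ℕ := fun n => ⌊(1 - t) * n⌋₊
  have hp : Tendsto p atTop atTop := tendsto_nat_floor_atTop.comp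
    (tendsto_natCast_atTop_atTop.const_mul_atTop h0)
  have hq : Tendsto q atTop atTop := tendsto_nat_floor_atTop.comp
    (tendsto_natCast_atTop_atTop.const_mul_atTop (sub_pos.2 h1))
  -- `uniformComb k` has `k + 1` terms, so the groups have sizes `p n + 1` and `q n + 1`, and
  -- neither is empty.
  set l : ℕ → ℝ := fun n => ((p n : ℝ) + 1) / ((p n + 1) + (q n + 1)) with hl
  have hl01 : ∀ n, 0 < l n ∧ l n < 1 := by
    intro n
    refine ⟨by positivity, ?_⟩
    rw [hl, div_lt_one (by positivity)]
    have : (0 : ℝ) < q n + 1 := by positivity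
    linarith
  have hl' : ∀ n, 1 - l n = ((q n : ℝ) + 1) / ((p n + 1) + (q n + 1)) := by
    intro n
    simp only [hl]
    field_simp
    ring
  have hinv : Tendsto (fun n : ℕ => (1 : ℝ) / (n : ℝ)) atTop (𝓝 0) :=
    tendsto_one_div_atTop_nhds_zero_nat
  have hpt : Tendsto (fun n : ℕ => (p n : ℝ) / n) atTop (𝓝 t) :=
    (tendsto_nat_floor_mul_div_atTop h0.le).comp tendsto_natCast_atTop_atTop
  have hqt : Tendsto (fun n : ℕ => (q n : ℝ) / n) atTop (𝓝 (1 - t)) :=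
    (tendsto_nat_floor_mul_div_atTop (sub_pos.2 h1).le).comp tendsto_natCast_atTop_atTop
  have hlt : Tendsto l atTop (𝓝 t) := by
    have h := (hpt.add hinv).div ((hpt.add hinv).add (hqt.add hinv)) (by simp)
    simp only [add_zero, add_sub_cancel, div_one] at h
    refine h.congr' ?_
    filter_upwards [eventually_gt_atTop 0] with n hn
    have : (0 : ℝ) < n := by exact_mod_cast hn
    simp only [hl, Pi.div_apply, ← add_div]
    field_simp
  have hcomb : ∀ n, uniformComb (p n + q n + 1) u =
      comb ![l n, 1 - l n] ![uniformComb (p n) u, uniformComb (q n) u] := by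
    intro n
    have h := nsmul_dirac one_pos (p n + q n + 1) u
    rw [show p n + q n + 1 + 1 = (p n + 1) + (q n + 1) by ring, add_nsmul,
      nsmul_dirac one_pos, nsmul_dirac one_pos, dirac_add_dirac (by positivity) (by positivity)] at h
    push_cast at h
    simp only [mul_one] at h
    rw [show (p n : ℝ) + q n + 1 + 1 = (p n + 1) + (q n + 1) by ring, ← hl'] at h
    exact (dirac_injective (by positivity) h).symm
  have hlim : Tendsto (fun n => uniformComb (p n + q n + 1) u) atTop (𝓝 (K u)) :=
    (tendsto_uniformComb u).comp (tendsto_atTop_mono (fun n => by omega) hp)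
  refine tendsto_nhds_unique ?_ hlim
  have h3 := comb_tendsto (K u) (K u) l t hl01 h0 h1 hlt
  rw [tendsto_iff_dist_tendsto_zero] at h3 ⊢
  have hpu := tendsto_iff_dist_tendsto_zero.1 ((tendsto_uniformComb u).comp hp)
  have hqu := tendsto_iff_dist_tendsto_zero.1 ((tendsto_uniformComb u).comp hq)
  have hsum := (hpu.add hqu).add h3
  simp only [add_zero] at hsum
  refine squeeze_zero (fun _ => dist_nonneg) (fun n => ?_) hsum
  rw [hcomb]
  refine (dist_triangle _ (comb ![l n, 1 - l n] ![K u, K u]) _).trans ?_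
  gcongr
  refine (dist_comb_le _ _ _ _ _ (hl01 n).1 (hl01 n).2).trans ?_
  have h5 := hl01 n
  gcongr
  · exact mul_le_of_le_one_left dist_nonneg h5.2.le
  · exact mul_le_of_le_one_left dist_nonneg (by linarith)

theorem dirac_K_add_dirac_K {r s : ℝ} (hr : 0 ≤ r) (hs : 0 ≤ s) (u : X) :
    dirac r (K u) + dirac s (K u) = dirac (r + s) (K u) := by
  rcases hr.lt_or_eq with hr | rfl
  · rcases hs.lt_or_eq with hs | rfl
    · rw [dirac_add_dirac hr hs, show s / (r + s) = 1 - r / (r + s) by field_simp; ring,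
        comb_two_K_self (by positivity) (by rw [div_lt_one (by positivity)]; linarith)]
    · simp
  · simp

theorem nsmul_dirac_K {r : ℝ} (hr : 0 ≤ r) (n : ℕ) (u : X) :
    n • dirac r (K u) = dirac (n * r) (K u) := by
  induction n with
  | zero => simp
  | succ n ih =>
    rw [succ_nsmul, ih, dirac_K_add_dirac_K (by positivity) hr]
    push_cast
    ring_nf

theorem K_K (u : X) : K (K u) = K u := by
  refine tendsto_nhds_unique (tendsto_uniformComb _) ?_
  have : ∀ n, uniformComb n (K u) = K u := by
    intro n
    have h := nsmul_dirac one_pos n (K u)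
    rw [nsmul_dirac_K zero_le_one] at h
    push_cast at h
    exact (dirac_injective (by positivity) h).symm
  simp only [this]
  exact tendsto_const_nhds

theorem mem_convexDomain_iff {x : X} : x ∈ convexDomain X ↔ K x = x :=
  ⟨by rintro ⟨u, rfl⟩; exact K_K u, fun h => ⟨x, h⟩⟩

theorem isClosed_convexDomain : IsClosed (convexDomain X) := by
  have : convexDomain X = {x | K x = x} := Set.ext fun x => mem_convexDomain_iff
  rw [this]
  exact isClosed_eq continuous_K continuous_id

/-- The convexification operator on the cone. -/
noncomputable def coneK : Cone X →+ Cone X :=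
  WithZero.mapAddHom
    { toFun := fun p : Atom X => (⟨p.mass, p.pos, K p.pt⟩ : Atom X)
      map_add' := by
        intro p q
        have hp := p.pos
        have hq := q.pos
        ext
        · rfl
        · simp only [Atom.pt_add]
          exact K_comb_two (by positivity) (by positivity) (by field_simp) _ _ }

@[simp]
theorem coneK_dirac (r : ℝ) (x : X) : coneK (dirac r x) = dirac r (K x) := by
  rcases lt_or_ge 0 r with h | h
  · rw [dirac_of_pos h, dirac_of_pos h]; rfl
  · rw [dirac_of_nonpos h, dirac_of_nonpos h, map_zero]

theorem mass_coneK (a : Cone X) : mass (coneK a) = mass a := by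
  by_cases h : a = 0
  · simp [h]
  · obtain ⟨r, x, hr, rfl⟩ := exists_eq_dirac a h
    rw [coneK_dirac, mass_dirac hr.le, mass_dirac hr.le]

/-- The copies of `a` are replaced by `b` one at a time. The single `c` takes part in every
replacement, so each costs at most `gap (a + c) (b + c)`. -/
theorem gap_nsmul_add_le {a b : Cone X} (h : mass a = mass b) (c : Cone X) (n : ℕ) :
    gap (n • a + c) (n • b + c) ≤ n * gap (a + c) (b + c) := by
  induction n with
  | zero => simp [gap_self]
  | succ n ih =>
    have h1 := gap_triangle (a := n • a + (a + c)) (b := n • a + (b + c)) (c := n • b + (b + c))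
      (by simp [h]) (by simp [h])
    have h2 := gap_add_le (a := n • a) (b := n • a) (c := a + c) (d := b + c) rfl (by simp [h])
    have h3 := gap_add_right_le (a := n • a + c) (b := n • b + c) (by simp [h]) b
    rw [gap_self] at h2
    rw [succ_nsmul, succ_nsmul, add_assoc, add_assoc]
    rw [show n • a + c + b = n • a + (b + c) by abel,
      show n • b + c + b = n • b + (b + c) by abel] at h3
    push_cast
    linarith

theorem le_of_forall_nat_mul_le {x y B : ℝ} (h : ∀ n : ℕ, n * x ≤ n * y + B) : x ≤ y := by
  by_contra! hlt
  obtain ⟨n, hn⟩ := exists_nat_gt (B / (x - y))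
  rw [div_lt_iff₀ (sub_pos.2 hlt)] at hn
  have := h n
  linarith

/-- Cancellation: on convex points the gap is translation invariant. -/
theorem gap_coneK_add_right {a b : Cone X} (h : mass a = mass b) (c : Cone X) :
    gap (coneK (a + c)) (coneK (b + c)) = gap (coneK a) (coneK b) := by
  rw [map_add, map_add]
  refine le_antisymm (gap_add_right_le (by simp [mass_coneK, h]) _) ?_
  by_cases ha : a = 0
  · subst ha
    rw [eq_zero_of_mass (a := b) (by rw [← h, map_zero]), map_zero, gap_zero, gap_self]
  by_cases hc : c = 0
  · subst hc; simp
  obtain ⟨r, x, y, hr, rfl, rfl⟩ := exists_dirac_of_mass_eq h ha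
  obtain ⟨s, z, hs, rfl⟩ := exists_eq_dirac c hc
  simp only [coneK_dirac]
  -- Multiples of a convex point stay at that point, so `n` copies of the first summand, padded by
  -- mass `s` at the same point, have gap `(n * r + s) * dist (K x) (K y)`. Moving the padding to `K
  -- z` costs at most `B`, independently of `n`.
  refine le_of_forall_nat_mul_le (B := s * dist (K x) (K z) + s * dist (K z) (K y)) fun n => ?_
  have h1 := gap_nsmul_add_le (a := dirac r (K x)) (b := dirac r (K y))
    (by simp [mass_dirac hr.le]) (dirac s (K z)) n
  have hm : ∀ u : X, mass (dirac s u) = s := mass_dirac hs.le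
  have hm' : ∀ u : X, mass (dirac r u) = r := mass_dirac hr.le
  have h2 := gap_triangle (a := n • dirac r (K x) + dirac s (K x))
    (b := n • dirac r (K x) + dirac s (K z)) (c := n • dirac r (K y) + dirac s (K y))
    (by simp [hm]) (by simp [hm, hm'])
  have h3 := gap_triangle (a := n • dirac r (K x) + dirac s (K z))
    (b := n • dirac r (K y) + dirac s (K z)) (c := n • dirac r (K y) + dirac s (K y))
    (by simp [hm, hm']) (by simp [hm])
  have h4 := gap_add_le (a := n • dirac r (K x)) (b := n • dirac r (K x))
    (c := dirac s (K x)) (d := dirac s (K z)) rfl (by simp [hm])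
  have h5 := gap_add_le (a := n • dirac r (K y)) (b := n • dirac r (K y))
    (c := dirac s (K z)) (d := dirac s (K y)) rfl (by simp [hm])
  rw [gap_self, gap_dirac hs.le, zero_add] at h4 h5
  have h6 : gap (n • dirac r (K x) + dirac s (K x)) (n • dirac r (K y) + dirac s (K y)) =
      (n * r + s) * dist (K x) (K y) := by
    rw [nsmul_dirac_K hr.le, nsmul_dirac_K hr.le, dirac_K_add_dirac_K (by positivity) hs.le,
      dirac_K_add_dirac_K (by positivity) hs.le, gap_dirac (by positivity)]
  have h7 : 0 ≤ s * dist (K x) (K y) := by positivity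
  rw [gap_dirac hr.le]
  linarith

end Gap

end CCSpace

-- The Banach space containing the convex points

universe u

theorem Seminorm.exists_linearMap_norm_eq {V : Type u} [AddCommGroup V] [Module ℝ V]
    (p : Seminorm ℝ V) : ∃ (E : Type u) (_ : NormedAddCommGroup E) (_ : NormedSpace ℝ E)
      (_ : CompleteSpace E) (L : V →ₗ[ℝ] E), ∀ v, ‖L v‖ = p v := by
  let : SeminormedAddCommGroup V := p.toAddGroupSeminorm.toSeminormedAddCommGroup
  let : NormedSpace ℝ V := { norm_smul_le := fun c v => (map_smul_eq_mul p c v).le }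
  exact ⟨UniformSpace.Completion V, inferInstance, inferInstance, inferInstance,
    (UniformSpace.Completion.toComplₗᵢ (𝕜 := ℝ) (E := V)).toLinearMap,
    fun v => (UniformSpace.Completion.toComplₗᵢ (𝕜 := ℝ) (E := V)).norm_map v⟩

namespace CCSpace

open scoped NNReal

section Embedding

variable {X : Type u}

/-- The positive part of a finitely supported function. -/
noncomputable def posPart (f : X →₀ ℝ) : X →₀ ℝ≥0 :=
  f.mapRange Real.toNNReal Real.toNNReal_zero

theorem posPart_sub_posPart_neg (f : X →₀ ℝ) (x : X) :
    f x = posPart f x - posPart (-f) x := by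
  simp only [posPart, Finsupp.mapRange_apply, Finsupp.neg_apply, Real.coe_toNNReal']
  rcases le_total 0 (f x) with h | h
  · rw [max_eq_left h, max_eq_right (by linarith)]; ring
  · rw [max_eq_right h, max_eq_left (by linarith)]; ring

variable [MetricSpace X] [CCSpace X]

/-- The translation invariant pseudometric on the cone which extends `gap`; `o` is a base point
used to balance the masses. -/
noncomputable def coneDist (o : X) (a b : Cone X) : ℝ :=
  gap (coneK a + dirac (mass b) (K o)) (coneK b + dirac (mass a) (K o))

theorem mass_balanced (o : X) (a b : Cone X) :
    mass (coneK a + dirac (mass b) (K o)) = mass a + mass b := by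
  rw [map_add, mass_coneK, mass_dirac (mass_nonneg b)]

theorem mass_balanced' (o : X) (a b : Cone X) :
    mass (coneK a + dirac (mass b) (K o)) = mass (coneK b + dirac (mass a) (K o)) := by
  rw [mass_balanced, mass_balanced, add_comm]

theorem gap_add_coneK {a b : Cone X} (h : mass a = mass b) (ha : coneK a = a) (hb : coneK b = b)
    {c : Cone X} (hc : coneK c = c) : gap (a + c) (b + c) = gap a b := by
  have := gap_coneK_add_right h c
  rwa [map_add, map_add, ha, hb, hc] at this

theorem coneK_coneK (a : Cone X) : coneK (coneK a) = coneK a := by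
  by_cases h : a = 0
  · simp [h]
  · obtain ⟨r, x, hr, rfl⟩ := exists_eq_dirac a h
    simp [K_K]

theorem coneDist_add_right (o : X) (a b c : Cone X) :
    coneDist o (a + c) (b + c) = coneDist o a b := by
  unfold coneDist
  rw [← gap_add_coneK (mass_balanced' o a b) (by simp [coneK_coneK, K_K])
    (by simp [coneK_coneK, K_K]) (c := coneK c + dirac (mass c) (K o))
    (by simp [coneK_coneK, K_K])]
  simp only [map_add, ← dirac_K_add_dirac_K (mass_nonneg _) (mass_nonneg c)]
  congr 1 <;> abel

theorem coneDist_self (o : X) (a : Cone X) : coneDist o a a = 0 := gap_self _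

theorem coneDist_comm (o : X) (a b : Cone X) : coneDist o a b = coneDist o b a :=
  gap_comm (mass_balanced' o a b)

theorem coneDist_triangle (o : X) (a b c : Cone X) :
    coneDist o a c ≤ coneDist o a b + coneDist o b c := by
  -- Extra mass at `K o` brings all three elements to the total mass of `a`, `b` and `c`, where
  -- `gap_triangle` applies.
  have key : ∀ a b c : Cone X, coneDist o a b =
      gap (coneK a + dirac (mass b) (K o) + dirac (mass c) (K o))
        (coneK b + dirac (mass a) (K o) + dirac (mass c) (K o)) := by
    intro a b c
    exact (gap_add_coneK (mass_balanced' o a b) (by simp [coneK_coneK, K_K])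
      (by simp [coneK_coneK, K_K]) (by simp [K_K])).symm
  rw [key a c b, key a b c, key b c a]
  have h := gap_triangle (a := coneK a + dirac (mass c) (K o) + dirac (mass b) (K o))
    (b := coneK b + dirac (mass a) (K o) + dirac (mass c) (K o))
    (c := coneK c + dirac (mass a) (K o) + dirac (mass b) (K o))
    (by simp only [map_add, mass_coneK, mass_dirac (mass_nonneg _)]; ring)
    (by simp only [map_add, mass_coneK, mass_dirac (mass_nonneg _)]; ring)
  convert h using 3
  · abel
  · abel
  · abel

theorem coneDist_scale (o : X) {c : ℝ} (hc : 0 < c) (a b : Cone X) :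
    coneDist o (scale c hc a) (scale c hc b) = c * coneDist o a b := by
  have hK : ∀ a : Cone X, coneK (scale c hc a) = scale c hc (coneK a) := by
    intro a
    by_cases h : a = 0
    · simp [h]
    · obtain ⟨r, x, hr, rfl⟩ := exists_eq_dirac a h
      simp
  unfold coneDist
  rw [mass_scale, mass_scale, ← gap_scale (mass_balanced' o a b) hc, map_add, map_add, hK, hK,
    scale_dirac, scale_dirac]

/-- The barycenter of a finitely supported positive measure, with its mass. -/
noncomputable def bar : (X →₀ ℝ≥0) →+ Cone X :=
  Finsupp.liftAddHom fun x =>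
    { toFun := fun r => dirac (r : ℝ) (K x)
      map_zero' := by simp
      map_add' := fun r s => by
        rw [NNReal.coe_add, dirac_K_add_dirac_K r.coe_nonneg s.coe_nonneg] }

theorem bar_single (x : X) (r : ℝ≥0) : bar (Finsupp.single x r) = dirac (r : ℝ) (K x) := by
  simp [bar]

theorem bar_smul {c : ℝ≥0} (hc : 0 < (c : ℝ)) (f : X →₀ ℝ≥0) :
    bar (c • f) = scale (c : ℝ) hc (bar f) := by
  induction f using Finsupp.induction_linear with
  | zero => simp
  | add f g hf hg => rw [smul_add, map_add, map_add, map_add, hf, hg]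
  | single x r => rw [Finsupp.smul_single, bar_single, bar_single, scale_dirac]; simp

/-- The distance of the barycenters of the positive and the negative part. -/
noncomputable def barNorm (o : X) (f : X →₀ ℝ) : ℝ :=
  coneDist o (bar (posPart f)) (bar (posPart (-f)))

/-- From `posPart f + h = g + posPart (-f)` and translation invariance. This freedom of
decomposition yields the seminorm properties. -/
theorem barNorm_eq (o : X) (f : X →₀ ℝ) (g h : X →₀ ℝ≥0) (hf : ∀ x, f x = g x - h x) :
    barNorm o f = coneDist o (bar g) (bar h) := by
  have e : posPart f + h = g + posPart (-f) := by
    ext x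
    have := posPart_sub_posPart_neg f x
    rw [hf] at this
    simp only [Finsupp.add_apply, NNReal.coe_add]
    linarith
  unfold barNorm
  rw [← coneDist_add_right o _ _ (bar h), ← map_add, e, map_add, add_comm (bar (posPart (-f))),
    coneDist_add_right]

theorem barNorm_add_le (o : X) (f g : X →₀ ℝ) :
    barNorm o (f + g) ≤ barNorm o f + barNorm o g := by
  rw [barNorm_eq o (f + g) (posPart f + posPart g) (posPart (-f) + posPart (-g)) (by
    intro x
    rw [Finsupp.add_apply, posPart_sub_posPart_neg f, posPart_sub_posPart_neg g]
    simp only [Finsupp.add_apply, NNReal.coe_add]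
    ring), map_add, map_add]
  refine (coneDist_triangle o _ (bar (posPart (-f)) + bar (posPart g)) _).trans ?_
  rw [coneDist_add_right, add_comm (bar (posPart (-f))), add_comm (bar (posPart (-f))),
    coneDist_add_right]
  rfl

theorem barNorm_neg (o : X) (f : X →₀ ℝ) : barNorm o (-f) = barNorm o f := by
  unfold barNorm
  rw [neg_neg, coneDist_comm]

theorem barNorm_smul_of_pos (o : X) {c : ℝ} (hc : 0 < c) (f : X →₀ ℝ) :
    barNorm o (c • f) = c * barNorm o f := by
  lift c to ℝ≥0 using hc.le
  rw [barNorm_eq o ((c : ℝ) • f) (c • posPart f) (c • posPart (-f)) (by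
      intro x
      rw [Finsupp.smul_apply, posPart_sub_posPart_neg f]
      simp only [Finsupp.smul_apply, smul_eq_mul, NNReal.coe_mul]
      ring), bar_smul hc, bar_smul hc, coneDist_scale]
  rfl

/-- `barNorm` as a seminorm. -/
noncomputable def barSeminorm (o : X) : Seminorm ℝ (X →₀ ℝ) :=
  Seminorm.of (barNorm o) (barNorm_add_le o) (by
    intro c f
    rcases lt_trichotomy c 0 with h | rfl | h
    · rw [← barNorm_neg, ← neg_smul, barNorm_smul_of_pos o (neg_pos.2 h), Real.norm_of_nonpos h.le]
    · rw [zero_smul, norm_zero, zero_mul, barNorm_eq o 0 0 0 (by simp), coneDist_self]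
    · rw [barNorm_smul_of_pos o h, Real.norm_of_nonneg h.le])

theorem barNorm_single_sub_single (o x y : X) :
    barNorm o (Finsupp.single x 1 - Finsupp.single y 1) = dist (K x) (K y) := by
  classical
  rw [barNorm_eq o _ (Finsupp.single x 1) (Finsupp.single y 1) (by
    intro z
    simp only [Finsupp.sub_apply, Finsupp.single_apply]
    split_ifs <;> simp), bar_single, bar_single]
  simp only [NNReal.coe_one, coneDist, mass_dirac zero_le_one, coneK_dirac]
  rw [gap_add_coneK (by simp [mass_dirac zero_le_one]) (by simp [K_K]) (by simp [K_K])
    (by simp [K_K]), gap_dirac zero_le_one, K_K, K_K, one_mul]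

/-- This null vector vanishes in the completion, which makes the embedding affine. -/
theorem barNorm_single_comb_two (o : X) {a b : ℝ} (ha : 0 < a) (hb : 0 < b) (hab : a + b = 1)
    (x y : X) : barNorm o (Finsupp.single (comb ![a, b] ![x, y]) 1 -
      (a • Finsupp.single x 1 + b • Finsupp.single y 1)) = 0 := by
  classical
  lift a to ℝ≥0 using ha.le
  lift b to ℝ≥0 using hb.le
  rw [barNorm_eq o _ (Finsupp.single (comb ![(a : ℝ), b] ![x, y]) 1)
    (a • Finsupp.single x 1 + b • Finsupp.single y 1) (by
    intro z
    simp only [Finsupp.sub_apply, Finsupp.add_apply, Finsupp.smul_apply, Finsupp.single_apply]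
    split_ifs <;> simp), map_add, bar_smul ha, bar_smul hb,
    bar_single, bar_single, bar_single, scale_dirac, scale_dirac]
  simp only [NNReal.coe_one, mul_one]
  rw [dirac_add_dirac ha hb, hab, div_one, div_one, K_comb_two ha hb hab, coneDist_self]

variable (X) in
/-- The convex domain embeds isometrically and affinely into a Banach space. -/
theorem exists_embedding [Nonempty X] : ∃ (E : Type u) (_ : NormedAddCommGroup E)
    (_ : NormedSpace ℝ E) (_ : CompleteSpace E) (φ : X → E),
    (∀ x y, dist (φ x) (φ y) = dist (K x) (K y)) ∧
    ∀ a b x y, 0 < a → 0 < b → a + b = 1 → φ (comb ![a, b] ![x, y]) = a • φ x + b • φ y := by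
  obtain ⟨o⟩ := ‹Nonempty X›
  obtain ⟨E, i1, i2, i3, L, hL⟩ := (barSeminorm o).exists_linearMap_norm_eq
  refine ⟨E, i1, i2, i3, fun x => L (Finsupp.single x 1), fun x y => ?_, ?_⟩
  · rw [dist_eq_norm, ← map_sub, hL]
    exact barNorm_single_sub_single o x y
  · intro a b x y ha hb hab
    rw [← sub_eq_zero, ← norm_eq_zero, ← map_smul, ← map_smul, ← map_add, ← map_sub, hL]
    exact barNorm_single_comb_two o ha hb hab x y

end Embedding

end CCSpace

namespace CCSpace

/-! ### Transport of combinations and limits along the embedding -/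

section Affine

variable {X : Type*} [MetricSpace X] [CCSpace X] {E : Type*} [NormedAddCommGroup E]
  [NormedSpace ℝ E]

/-- A map into a normed space which is affine, and isometric up to convexification. -/
structure IsAffineIsometry (φ : X → E) : Prop where
  dist_eq : ∀ x y, dist (φ x) (φ y) = dist (K x) (K y)
  comb_two : ∀ a b x y, 0 < a → 0 < b → a + b = 1 →
    φ (comb ![a, b] ![x, y]) = a • φ x + b • φ y

theorem K_comb {n : ℕ} (w : Fin n → ℝ) (x : Fin n → X) (hw : ∀ i, 0 < w i)
    (h : ∑ i, w i = 1) : K (comb w x) = comb w (K ∘ x) := by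
  cases n with
  | zero => simp at h
  | succ n =>
    have h1 := congrArg coneK (sum_dirac w x hw h)
    rw [map_sum, coneK_dirac] at h1
    simp only [coneK_dirac] at h1
    exact dirac_injective one_pos (h1.symm.trans (sum_dirac w (K ∘ x) hw h))

theorem sum_equivFin_symm {ι M : Type*} [AddCommMonoid M] (s : Finset ι) (f : ι → M) :
    ∑ k, f (s.equivFin.symm k) = ∑ i ∈ s, f i := by
  rw [Equiv.sum_comp s.equivFin.symm (fun i : s => f i), Finset.sum_coe_sort]

theorem sum_filter_pos {ι M : Type*} [AddCommGroup M] [Module ℝ M] (V : Finset ι) (w : ι → ℝ)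
    (hw : ∀ i ∈ V, 0 ≤ w i) (f : ι → M) :
    ∑ i ∈ V.filter (fun i => 0 < w i), w i • f i = ∑ i ∈ V, w i • f i := by
  rw [Finset.sum_filter]
  refine Finset.sum_congr rfl fun i hi => ?_
  split_ifs with h
  · rfl
  · rw [le_antisymm (not_lt.1 h) (hw i hi), zero_smul]

theorem sum_weights_combOn {ι : Type*} (V : Finset ι) (w : ι → ℝ)
    (hw : ∀ i ∈ V, 0 ≤ w i) (h : ∑ i ∈ V, w i = 1) :
    ∑ k, w ((V.filter (fun i => 0 < w i)).equivFin.symm k) = 1 := by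
  rw [sum_equivFin_symm, ← h]
  simpa using sum_filter_pos V w hw (fun _ => (1 : ℝ))

theorem weights_combOn_pos {ι : Type*} (V : Finset ι) (w : ι → ℝ)
    (k : Fin (V.filter (fun i => 0 < w i)).card) :
    0 < w ((V.filter (fun i => 0 < w i)).equivFin.symm k) :=
  (Finset.mem_filter.1 ((V.filter (fun i => 0 < w i)).equivFin.symm k).2).2

theorem combOn_K_mem {ι : Type*} (V : Finset ι) (w : ι → ℝ) (x : ι → X)
    (hw : ∀ i ∈ V, 0 ≤ w i) (h : ∑ i ∈ V, w i = 1) :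
    combOn V w (fun i => K (x i)) ∈ convexDomain X :=
  ⟨_, K_comb _ (fun k => x ((V.filter (fun i => 0 < w i)).equivFin.symm k))
    (weights_combOn_pos V w) (sum_weights_combOn V w hw h)⟩

theorem combOn_singleton {ι : Type*} (V : Finset ι) (w : ι → ℝ) (x : ι → X) (i₀ : ι)
    (h₀ : V.filter (fun i => 0 < w i) = {i₀}) (h : w i₀ = 1) : combOn V w x = x i₀ := by
  -- The index type depends on the filtered set, so the set is generalized before substituting.
  have key : ∀ s : Finset ι, s = {i₀} →
      comb (fun k => w (s.equivFin.symm k)) (fun k => x (s.equivFin.symm k)) = x i₀ := by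
    rintro s rfl
    have hk : ∀ k, (({i₀} : Finset ι).equivFin.symm k : ι) = i₀ := fun k =>
      Finset.mem_singleton.1 (({i₀} : Finset ι).equivFin.symm k).2
    simp only [hk, h]
    exact comb_one (x i₀)
  exact key _ h₀

namespace IsAffineIsometry

variable {φ : X → E} (hφ : IsAffineIsometry φ)

include hφ

theorem apply_K (x : X) : φ (K x) = φ x := by
  rw [← dist_eq_zero, hφ.dist_eq, K_K, dist_self]

theorem dist_le (x y : X) : dist (φ x) (φ y) ≤ dist x y :=
  (hφ.dist_eq x y).trans_le (dist_K_le x y)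

theorem dist_eq_of_mem {x y : X} (hx : x ∈ convexDomain X) (hy : y ∈ convexDomain X) :
    dist (φ x) (φ y) = dist x y := by
  rw [hφ.dist_eq, mem_convexDomain_iff.1 hx, mem_convexDomain_iff.1 hy]

theorem continuous : Continuous φ := (LipschitzWith.mk_one hφ.dist_le).continuous

theorem map_comb {n : ℕ} (w : Fin n → ℝ) (x : Fin n → X) (hw : ∀ i, 0 < w i)
    (h : ∑ i, w i = 1) : φ (comb w x) = ∑ i, w i • φ (x i) := by
  cases n with
  | zero => simp at h
  | succ n =>
    -- An affine map extends additively to the cone, and `sum_dirac` then handles combinations of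
    -- any length.
    let Φ : Cone X →+ E := WithZero.lift
      { toFun := fun p : Atom X => p.mass • φ p.pt
        map_add' := by
          intro p q
          have hp := p.pos
          have hq := q.pos
          rw [Atom.pt_add, Atom.mass_add, hφ.comb_two _ _ _ _ (by positivity) (by positivity)
            (by field_simp), smul_add, smul_smul, smul_smul, mul_div_cancel₀ _ (by positivity),
            mul_div_cancel₀ _ (by positivity)] }
    have hΦ : ∀ r x, 0 < r → Φ (dirac r x) = r • φ x := by
      intro r x hr
      rw [dirac_of_pos hr]
      rfl
    have h1 := congrArg Φ (sum_dirac w x hw h)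
    rw [map_sum, hΦ _ _ one_pos, one_smul] at h1
    rw [← h1]
    exact Finset.sum_congr rfl fun i _ => hΦ _ _ (hw i)

theorem map_combOn {ι : Type*} (V : Finset ι) (w : ι → ℝ) (x : ι → X)
    (hw : ∀ i ∈ V, 0 ≤ w i) (h : ∑ i ∈ V, w i = 1) :
    φ (combOn V w x) = ∑ i ∈ V, w i • φ (x i) := by
  rw [combOn, hφ.map_comb _ _ (weights_combOn_pos V w) (sum_weights_combOn V w hw h),
    sum_equivFin_symm _ (fun i => w i • φ (x i)), sum_filter_pos V w hw]

theorem cauchySeq_of_tendsto {s : ℕ → X} (hs : ∀ n, s n ∈ convexDomain X) {e : E}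
    (h : Tendsto (fun n => φ (s n)) atTop (𝓝 e)) : CauchySeq s := by
  rw [Metric.cauchySeq_iff]
  intro ε hε
  obtain ⟨N, hN⟩ := Metric.cauchySeq_iff.1 h.cauchySeq ε hε
  refine ⟨N, fun m hm n hn => ?_⟩
  rw [← hφ.dist_eq_of_mem (hs m) (hs n)]
  exact hN m hm n hn

/-- The convex domain is closed and `φ` is isometric on it, so limits in `X` become equations in
`E`. -/
theorem tendsto_iff {s : ℕ → X} (hs : ∀ n, s n ∈ convexDomain X) {e : E}
    (h : Tendsto (fun n => φ (s n)) atTop (𝓝 e)) (y : X) :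
    Tendsto s atTop (𝓝 y) ↔ y ∈ convexDomain X ∧ φ y = e := by
  constructor
  · intro hy
    exact ⟨isClosed_convexDomain.mem_of_tendsto hy (Eventually.of_forall hs),
      tendsto_nhds_unique ((hφ.continuous.tendsto y).comp hy) h⟩
  · rintro ⟨hy, rfl⟩
    rw [tendsto_iff_dist_tendsto_zero] at h ⊢
    simpa only [hφ.dist_eq_of_mem (hs _) hy] using h

end IsAffineIsometry

end Affine

/-! ### Nearest-point approximation -/

section Approx

variable {X : Type*} [MetricSpace X]

theorem nearestIndex_spec (u : ℕ → X) (n : ℕ) (x : X) :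
    nearestIndex u n x ≤ n ∧ ∀ j ≤ n, dist (u (nearestIndex u n x)) x ≤ dist (u j) x := by
  refine Nat.sInf_mem (s := {i : ℕ | i ≤ n ∧ ∀ j ≤ n, dist (u i) x ≤ dist (u j) x}) ?_
  obtain ⟨i, hi, h⟩ := Finset.exists_min_image (Finset.range (n + 1)) (fun i => dist (u i) x)
    ⟨0, by simp⟩
  exact ⟨i, by simpa [Nat.lt_succ_iff] using hi, fun j hj => h j (by simpa [Nat.lt_succ_iff] using hj)⟩

theorem approx_mem (u : ℕ → X) (n : ℕ) (x : X) : approx u n x ∈ firstPoints u n := by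
  classical
  rw [firstPoints, Finset.mem_image]
  exact ⟨_, by simpa [Nat.lt_succ_iff] using (nearestIndex_spec u n x).1, rfl⟩

theorem dist_approx_le (u : ℕ → X) {n j : ℕ} (h : j ≤ n) (x : X) :
    dist (approx u n x) x ≤ dist (u j) x :=
  (nearestIndex_spec u n x).2 j h

theorem antitone_dist_approx (u : ℕ → X) (x : X) : Antitone fun n => dist (approx u n x) x :=
  fun n _ h => dist_approx_le u ((nearestIndex_spec u n x).1.trans h) x

theorem tendsto_dist_approx {u : ℕ → X} (hu : DenseRange u) (x : X) :
    Tendsto (fun n => dist (approx u n x) x) atTop (𝓝 0) := by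
  rw [Metric.tendsto_atTop]
  intro ε hε
  obtain ⟨j, hj⟩ := hu.exists_dist_lt x hε
  refine ⟨j, fun n hn => ?_⟩
  rw [Real.dist_0_eq_abs, abs_of_nonneg dist_nonneg]
  exact (dist_approx_le u hn x).trans_lt (by rwa [dist_comm])

theorem measurable_approx [MeasurableSpace X] [BorelSpace X] (u : ℕ → X) (n : ℕ) :
    Measurable (approx u n) := by
  have hd : ∀ i, Measurable fun x => dist (u i) x := fun i =>
    (continuous_const.dist continuous_id).measurable
  have hM : ∀ i, MeasurableSet {x : X | i ≤ n ∧ ∀ j ≤ n, dist (u i) x ≤ dist (u j) x} := by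
    intro i
    have : {x : X | i ≤ n ∧ ∀ j ≤ n, dist (u i) x ≤ dist (u j) x} =
        {_x : X | i ≤ n} ∩ ⋂ j : ℕ, ⋂ _ : j ≤ n, {x : X | dist (u i) x ≤ dist (u j) x} := by
      ext x
      simp
    rw [this]
    exact (MeasurableSet.const _).inter (MeasurableSet.iInter fun j => MeasurableSet.iInter
      fun _ => measurableSet_le (hd i) (hd j))
  refine (measurable_from_top (f := u)).comp (measurable_to_countable' fun i => ?_)
  have : nearestIndex u n ⁻¹' {i} =
      {x : X | i ≤ n ∧ ∀ j ≤ n, dist (u i) x ≤ dist (u j) x} ∩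
        ⋂ k : ℕ, ⋂ _ : k < i, {x : X | k ≤ n ∧ ∀ j ≤ n, dist (u k) x ≤ dist (u j) x}ᶜ := by
    ext x
    simp only [Set.mem_preimage, Set.mem_singleton_iff, Set.mem_inter_iff, Set.mem_iInter,
      Set.mem_compl_iff]
    constructor
    · rintro rfl
      exact ⟨nearestIndex_spec u n x, fun k hk => Nat.notMem_of_lt_sInf hk⟩
    · rintro ⟨h1, h2⟩
      refine le_antisymm (Nat.sInf_le h1) ?_
      by_contra! hlt
      exact h2 _ hlt (nearestIndex_spec u n x)
  rw [this]
  exact (hM i).inter (MeasurableSet.iInter fun k => MeasurableSet.iInter fun _ => (hM k).compl)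

end Approx

end CCSpace

/-! ### Conditional expectations decreasing to zero -/

namespace MeasureTheory

/-- Monotonicity and nonnegativity give an a.s. limit. Dominated convergence and `L¹` contractivity
give a subsequence tending to zero a.s., which identifies it. -/
theorem ae_tendsto_condExp_zero_of_antitone {Ω : Type*} {m mΩ : MeasurableSpace Ω} {P : Measure Ω}
    [IsFiniteMeasure P] {g : ℕ → Ω → ℝ} (hg : ∀ n, AEStronglyMeasurable (g n) P)
    (hg0 : ∀ n ω, 0 ≤ g n ω) (hanti : ∀ ω, Antitone fun n => g n ω) (hint : Integrable (g 0) P)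
    (hlim : ∀ ω, Tendsto (fun n => g n ω) atTop (𝓝 0)) :
    ∀ᵐ ω ∂P, Tendsto (fun n => (P[g n | m]) ω) atTop (𝓝 0) := by
  have hbound : ∀ n ω, ‖g n ω‖ ≤ g 0 ω := fun n ω => by
    rw [Real.norm_of_nonneg (hg0 n ω)]
    exact hanti ω (Nat.zero_le n)
  have hgi : ∀ n, Integrable (g n) P := fun n =>
    hint.mono' (hg n) (Eventually.of_forall (hbound n))
  have h1 : Tendsto (fun n => eLpNorm (P[g n | m] - 0) 1 P) atTop (𝓝 0) := by
    have h := tendsto_lintegral_norm_of_dominated_convergence hg hint.2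
      (fun n => Eventually.of_forall (hbound n)) (Eventually.of_forall hlim)
    refine tendsto_of_tendsto_of_tendsto_of_le_of_le tendsto_const_nhds h (fun _ => zero_le)
      (fun n => ?_)
    rw [sub_zero]
    refine (eLpNorm_condExp_le_eLpNorm (g n) le_rfl).trans ?_
    rw [eLpNorm_one_eq_lintegral_enorm]
    simp only [sub_zero, ofReal_norm]
    exact le_rfl
  obtain ⟨ns, hns, hlim'⟩ := (tendstoInMeasure_of_tendsto_eLpNorm one_ne_zero
    (fun n => (integrable_condExp (m := m) (f := g n)).1) aestronglyMeasurable_zero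
    h1).exists_seq_tendsto_ae
  have hmono : ∀ᵐ ω ∂P, ∀ n, (P[g (n + 1) | m]) ω ≤ (P[g n | m]) ω :=
    ae_all_iff.2 fun n => condExp_mono (hgi _) (hgi _)
      (Eventually.of_forall fun ω => hanti ω n.le_succ)
  have hnonneg : ∀ᵐ ω ∂P, ∀ n, 0 ≤ (P[g n | m]) ω :=
    ae_all_iff.2 fun n => condExp_nonneg (Eventually.of_forall (hg0 n))
  filter_upwards [hlim', hmono, hnonneg] with ω h1 h2 h3
  have h4 := tendsto_atTop_ciInf (antitone_nat_of_succ_le h2)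
    ⟨(0 : ℝ), by rintro _ ⟨n, rfl⟩; exact h3 n⟩
  rwa [tendsto_nhds_unique (h4.comp hns.tendsto_atTop) h1] at h4

end MeasureTheory

namespace CCSpace

/-! ### Conditional expectations in `X` as Bochner conditional expectations -/

section Probability

variable {X : Type*} [MetricSpace X] [CCSpace X] [MeasurableSpace X] [BorelSpace X]
  {E : Type*} [NormedAddCommGroup E] [NormedSpace ℝ E] [CompleteSpace E] {φ : X → E}
  {Ω : Type*} {mΩ : MeasurableSpace Ω} {P : Measure Ω}

omit [CCSpace X] in
theorem integrable_indicator_fiber [IsFiniteMeasure P] {S : Ω → X} (hS : AEMeasurable S P)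
    (x : X) : Integrable ((S ⁻¹' {x}).indicator (fun _ => (1 : ℝ))) P :=
  (integrable_const 1).indicator₀ (hS.nullMeasurable (measurableSet_singleton x))

/-- `φ ∘ S` is the sum of the indicators of `S = x` times `φ x`; conditioning is linear, and the
conditional weights are a.s. nonnegative with sum one. -/
theorem ae_simpleCondExp [IsProbabilityMeasure P] (hφ : IsAffineIsometry φ)
    {G : MeasurableSpace Ω} (hG : G ≤ mΩ) {S : Ω → X} (hS : AEMeasurable S P) (V : Finset X)
    (hV : ∀ ω, S ω ∈ V) :
    ∀ᵐ ω ∂P, simpleCondExp P G V S ω ∈ convexDomain X ∧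
      φ (simpleCondExp P G V S ω) = (P[φ ∘ S | G]) ω := by
  classical
  set f : X → Ω → ℝ := fun x => (S ⁻¹' {x}).indicator (fun _ => (1 : ℝ)) with hf
  have hfi : ∀ x, Integrable (f x) P := fun x => integrable_indicator_fiber hS x
  have hfapp : ∀ x ω, f x ω = if x = S ω then 1 else 0 := by
    intro x ω
    simp only [hf, Set.indicator, Set.mem_preimage, Set.mem_singleton_iff, eq_comm]
  have hnonneg : ∀ᵐ ω ∂P, ∀ x ∈ V, 0 ≤ (P[f x | G]) ω :=
    (ae_ball_iff V.countable_toSet).2 fun x _ => condExp_nonneg (Eventually.of_forall fun ω => by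
      rw [hfapp]
      split_ifs <;> simp)
  have hsum : ∑ x ∈ V, f x = fun _ => 1 := by
    ext ω
    rw [Finset.sum_apply]
    simp only [hfapp]
    rw [Finset.sum_ite_eq' V (S ω), if_pos (hV ω)]
  have hone := condExp_finsetSum (s := V) (fun x _ => hfi x) G
  rw [hsum, condExp_const hG] at hone
  have hφS : φ ∘ S = ∑ x ∈ V, ((ContinuousLinearMap.toSpanSingleton ℝ (φ x)) ∘ f x) := by
    ext ω
    rw [Finset.sum_apply]
    simp only [Function.comp_apply, hfapp, ContinuousLinearMap.toSpanSingleton_apply, ite_smul,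
      one_smul, zero_smul]
    rw [Finset.sum_ite_eq' V (S ω), if_pos (hV ω)]
  have hvec := condExp_finsetSum (s := V) (fun x _ =>
    (ContinuousLinearMap.toSpanSingleton ℝ (φ x)).integrable_comp (hfi x)) G
  have hcomm : ∀ᵐ ω ∂P, ∀ x ∈ V, (P[f x | G]) ω • φ x =
      (P[(ContinuousLinearMap.toSpanSingleton ℝ (φ x)) ∘ f x | G]) ω :=
    (ae_ball_iff V.countable_toSet).2 fun x _ =>
      ContinuousLinearMap.comp_condExp_comm (hfi x) (ContinuousLinearMap.toSpanSingleton ℝ (φ x))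
  filter_upwards [hnonneg, hone, hvec, hcomm] with ω h1 h2 h3 h4
  rw [Finset.sum_apply] at h2 h3
  refine ⟨combOn_K_mem V _ id h1 h2.symm, ?_⟩
  rw [simpleCondExp, hφ.map_combOn V _ _ h1 h2.symm, hφS]
  refine (Finset.sum_congr rfl fun x hx => ?_).trans h3.symm
  rw [hφ.apply_K]
  exact h4 x hx

/-- Makes expectation the case of the trivial σ-algebra, so results on `IsCondExp` also cover
`HasExp`. -/
theorem simpleCondExp_bot [IsProbabilityMeasure P] {S : Ω → X} (hS : AEMeasurable S P)
    (V : Finset X) (ω : Ω) : simpleCondExp P ⊥ V S ω = simpleExp P V S := by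
  unfold simpleCondExp simpleExp
  congr 1
  ext x
  rw [condExp_bot, integral_indicator₀ (hS.nullMeasurable (measurableSet_singleton x))]
  simp

variable [TopologicalSpace.SeparableSpace X]

omit [CompleteSpace E] in
theorem integrable_comp [IsFiniteMeasure P] (hφ : IsAffineIsometry φ) {Z : Ω → X}
    (hZ : AEMeasurable Z P) {c : X} (hc : Integrable (fun ω => dist c (Z ω)) P) :
    Integrable (φ ∘ Z) P := by
  have := UniformSpace.secondCountable_of_separable X
  refine ((integrable_const ‖φ c‖).add hc).mono'
    (hφ.continuous.comp_aestronglyMeasurable hZ.aestronglyMeasurable)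
    (Eventually.of_forall fun ω => ?_)
  have h1 := hφ.dist_le c (Z ω)
  rw [dist_comm, dist_eq_norm] at h1
  have h2 := norm_le_norm_add_norm_sub' (φ (Z ω)) (φ c)
  simp only [Function.comp_apply, Pi.add_apply]
  linarith

omit [CCSpace X] in
theorem integrable_dist_change [IsFiniteMeasure P] {Z : Ω → X}
    (hZ : AEMeasurable Z P) {c : X} (hc : Integrable (fun ω => dist c (Z ω)) P) (c' : X) :
    Integrable (fun ω => dist c' (Z ω)) P := by
  have := UniformSpace.secondCountable_of_separable X
  refine ((integrable_const (dist c' c)).add hc).mono'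
    (aestronglyMeasurable_const.dist hZ.aestronglyMeasurable) (Eventually.of_forall fun ω => ?_)
  rw [Real.norm_of_nonneg dist_nonneg]
  exact dist_triangle _ _ _

theorem ae_tendsto_simpleCondExp [IsProbabilityMeasure P] (hφ : IsAffineIsometry φ)
    {G : MeasurableSpace Ω} (hG : G ≤ mΩ) {u : ℕ → X} (hu : DenseRange u) {Z : Ω → X}
    (hZ : AEMeasurable Z P) {c : X} (hc : Integrable (fun ω => dist c (Z ω)) P) :
    ∀ᵐ ω ∂P, (∀ n, simpleCondExp P G (firstPoints u n) (approx u n ∘ Z) ω ∈ convexDomain X) ∧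
      Tendsto (fun n => φ (simpleCondExp P G (firstPoints u n) (approx u n ∘ Z) ω)) atTop
        (𝓝 ((P[φ ∘ Z | G]) ω)) := by
  have := UniformSpace.secondCountable_of_separable X
  have hS : ∀ n, AEMeasurable (approx u n ∘ Z) P := fun n =>
    (measurable_approx u n).comp_aemeasurable hZ
  set g : ℕ → Ω → ℝ := fun n ω => dist (approx u n (Z ω)) (Z ω) with hg
  have hgm : ∀ n, AEStronglyMeasurable[mΩ] (g n) P := fun n =>
    (hS n).aestronglyMeasurable.dist hZ.aestronglyMeasurable
  have hgi : ∀ n, Integrable (g n) P := fun n =>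
    (integrable_dist_change hZ hc (u 0)).mono' (hgm n) (Eventually.of_forall fun ω => by
      rw [Real.norm_of_nonneg dist_nonneg]
      exact dist_approx_le u (Nat.zero_le n) _)
  have hφZ := integrable_comp hφ hZ hc
  have hφS : ∀ n, Integrable (φ ∘ approx u n ∘ Z) P := by
    intro n
    refine integrable_comp hφ (hS n) (c := u 0)
      (((integrable_dist_change hZ hc (u 0)).add (hgi n)).mono'
        (aestronglyMeasurable_const.dist (hS n).aestronglyMeasurable)
        (Eventually.of_forall fun ω => ?_))
    rw [Real.norm_of_nonneg dist_nonneg]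
    exact dist_triangle_right _ _ _
  have h0 := ae_tendsto_condExp_zero_of_antitone (m := G) hgm (fun _ _ => dist_nonneg)
    (fun ω => antitone_dist_approx u (Z ω)) (hgi 0) (fun ω => tendsto_dist_approx hu (Z ω))
  have h1 : ∀ᵐ ω ∂P, ∀ n, ‖(P[φ ∘ approx u n ∘ Z | G]) ω - (P[φ ∘ Z | G]) ω‖ ≤
      (P[g n | G]) ω := by
    refine ae_all_iff.2 fun n => ?_
    have hle : (P[fun ω => ‖(φ ∘ approx u n ∘ Z - φ ∘ Z) ω‖ | G]) ≤ᵐ[P] P[g n | G] :=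
      condExp_mono ((hφS n).sub hφZ).norm (hgi n) (Eventually.of_forall fun ω => by
        simp only [Pi.sub_apply, Function.comp_apply, ← dist_eq_norm]
        exact hφ.dist_le _ _)
    filter_upwards [condExp_sub (hφS n) hφZ G, norm_condExp_le (m := G) (μ := P)
      (φ ∘ approx u n ∘ Z - φ ∘ Z), hle] with ω e1 e2 e3
    rw [e1, Pi.sub_apply] at e2
    exact e2.trans e3
  have h2 : ∀ᵐ ω ∂P, ∀ n, _ := ae_all_iff.2 fun n =>
    ae_simpleCondExp hφ hG (hS n) (firstPoints u n) (fun ω => approx_mem u n _)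
  filter_upwards [h0, h1, h2] with ω e0 e1 e2
  refine ⟨fun n => (e2 n).1, ?_⟩
  simp only [fun n => (e2 n).2]
  rw [tendsto_iff_norm_sub_tendsto_zero]
  exact squeeze_zero (fun _ => norm_nonneg _) e1 e0

theorem isCondExp_iff [IsProbabilityMeasure P] (hφ : IsAffineIsometry φ)
    {G : MeasurableSpace Ω} (hG : G ≤ mΩ) {u : ℕ → X} (hu : DenseRange u) {Z : Ω → X}
    (hZ : AEMeasurable Z P) {c : X} (hc : Integrable (fun ω => dist c (Z ω)) P) (Y : Ω → X) :
    IsCondExp P G u Z Y ↔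
      (∀ᵐ ω ∂P, Y ω ∈ convexDomain X) ∧ φ ∘ Y =ᵐ[P] P[φ ∘ Z | G] := by
  rw [IsCondExp, EventuallyEq, ← eventually_and]
  refine eventually_congr ?_
  filter_upwards [ae_tendsto_simpleCondExp hφ hG hu hZ hc] with ω h
  exact hφ.tendsto_iff h.1 h.2 (Y ω)

theorem exists_isCondExp [CompleteSpace X] [IsProbabilityMeasure P] (hφ : IsAffineIsometry φ)
    {G : MeasurableSpace Ω} (hG : G ≤ mΩ) {u : ℕ → X} (hu : DenseRange u) {Z : Ω → X}
    (hZ : AEMeasurable Z P) {c : X} (hc : Integrable (fun ω => dist c (Z ω)) P) :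
    ∃ Y, IsCondExp P G u Z Y := by
  classical
  have h : ∀ᵐ ω ∂P, ∃ y, Tendsto
      (fun n => simpleCondExp P G (firstPoints u n) (approx u n ∘ Z) ω) atTop (𝓝 y) := by
    filter_upwards [ae_tendsto_simpleCondExp hφ hG hu hZ hc] with ω h
    exact cauchySeq_tendsto_of_complete (hφ.cauchySeq_of_tendsto h.1 h.2)
  -- The value `c` where no limit exists only matters on a null set.
  refine ⟨fun ω => if hω : _ then Classical.choose (p := fun y => Tendsto
      (fun n => simpleCondExp P G (firstPoints u n) (approx u n ∘ Z) ω) atTop (𝓝 y)) hω else c, ?_⟩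
  filter_upwards [h] with ω hω
  rw [dif_pos hω]
  exact Classical.choose_spec hω

omit [TopologicalSpace.SeparableSpace X] in
theorem hasExp_iff_isCondExp_bot [IsProbabilityMeasure P] {u : ℕ → X} {Z : Ω → X}
    (hZ : AEMeasurable Z P) (e : X) : HasExp P u Z e ↔ IsCondExp P ⊥ u Z (fun _ => e) := by
  have hS : ∀ n, AEMeasurable (approx u n ∘ Z) P := fun n =>
    (measurable_approx u n).comp_aemeasurable hZ
  simp only [IsCondExp, simpleCondExp_bot (hS _), eventually_const, HasExp]

theorem hasExp_iff [IsProbabilityMeasure P] (hφ : IsAffineIsometry φ) {u : ℕ → X}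
    (hu : DenseRange u) {Z : Ω → X} (hZ : AEMeasurable Z P) {c : X}
    (hc : Integrable (fun ω => dist c (Z ω)) P) (e : X) :
    HasExp P u Z e ↔ e ∈ convexDomain X ∧ φ e = ∫ ω, φ (Z ω) ∂P := by
  rw [hasExp_iff_isCondExp_bot hZ, isCondExp_iff hφ bot_le hu hZ hc, condExp_bot, EventuallyEq]
  simp only [Function.comp_apply, eventually_const]

theorem exists_hasExp [CompleteSpace X] [IsProbabilityMeasure P] (hφ : IsAffineIsometry φ)
    {u : ℕ → X} (hu : DenseRange u) {Z : Ω → X} (hZ : AEMeasurable Z P) {c : X}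
    (hc : Integrable (fun ω => dist c (Z ω)) P) : ∃ e, HasExp P u Z e := by
  obtain ⟨Y, hY⟩ := exists_isCondExp (P := P) hφ bot_le hu hZ hc
  rw [isCondExp_iff hφ bot_le hu hZ hc, condExp_bot] at hY
  obtain ⟨ω, h1, h2⟩ := (hY.1.and hY.2).exists
  exact ⟨Y ω, (hasExp_iff hφ hu hZ hc _).2 ⟨h1, h2⟩⟩

omit [CCSpace X] [BorelSpace X] [TopologicalSpace.SeparableSpace X] in
theorem MemL1.aemeasurable {G : MeasurableSpace Ω} (hG : G ≤ mΩ) {C : Set X} {Y : Ω → X}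
    (h : MemL1 P G C Y) : AEMeasurable Y P := by
  obtain ⟨Y', hY', -, -, he⟩ := h
  exact ⟨Y', hY'.mono hG le_rfl, he⟩

omit [CCSpace X] [BorelSpace X] [TopologicalSpace.SeparableSpace X] in
theorem MemL1.exists_integrable_dist {G : MeasurableSpace Ω} {C : Set X} {Y : Ω → X}
    (h : MemL1 P G C Y) : ∃ c, Integrable (fun ω => dist c (Y ω)) P := by
  obtain ⟨Y', -, -, ⟨c, hc⟩, he⟩ := h
  exact ⟨c, hc.congr (he.mono fun ω hω => by simp only [hω])⟩

omit [MeasurableSpace X] [BorelSpace X] [TopologicalSpace.SeparableSpace X] in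
theorem mix_eq_piecewise (A : Set Ω) [DecidablePred (· ∈ A)] (Z : Ω → X) (a : X) :
    mix A Z a = A.piecewise Z (fun _ => a) := by
  ext ω
  by_cases h : ω ∈ A
  · rw [Set.piecewise_eq_of_mem _ _ _ h]
    refine combOn_singleton _ _ _ (0 : Fin 2) ?_ (by simp [h])
    ext i
    fin_cases i <;> simp [h]
  · rw [Set.piecewise_eq_of_notMem _ _ _ h]
    refine combOn_singleton _ _ _ (1 : Fin 2) ?_ (by simp [h])
    ext i
    fin_cases i <;> simp [h]

omit [BorelSpace X] [TopologicalSpace.SeparableSpace X] in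
theorem aemeasurable_mix {A : Set Ω} (hA : MeasurableSet A) {Z : Ω → X} (hZ : AEMeasurable Z P)
    (a : X) : AEMeasurable (mix A Z a) P := by
  classical
  rw [mix_eq_piecewise]
  refine ⟨A.piecewise (hZ.mk Z) fun _ => a, hZ.measurable_mk.piecewise hA measurable_const, ?_⟩
  filter_upwards [hZ.ae_eq_mk] with ω hω
  simp only [Set.piecewise, hω]

theorem integrable_dist_mix [IsFiniteMeasure P] {A : Set Ω} (hA : MeasurableSet A) {Z : Ω → X}
    (hZ : AEMeasurable Z P) {c : X} (hc : Integrable (fun ω => dist c (Z ω)) P) (a : X) :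
    Integrable (fun ω => dist c (mix A Z a ω)) P := by
  classical
  have := UniformSpace.secondCountable_of_separable X
  refine (hc.add (integrable_const (dist c a))).mono'
    (aestronglyMeasurable_const.dist (aemeasurable_mix hA hZ a).aestronglyMeasurable)
    (Eventually.of_forall fun ω => ?_)
  rw [Real.norm_of_nonneg dist_nonneg, mix_eq_piecewise]
  by_cases h : ω ∈ A <;> simp [h]

omit [CompleteSpace E] in
theorem integral_mix [IsFiniteMeasure P] (hφ : IsAffineIsometry φ) {A : Set Ω}
    (hA : MeasurableSet A) {Z : Ω → X}
    (hZ : AEMeasurable Z P) {c : X} (hc : Integrable (fun ω => dist c (Z ω)) P) (a : X) :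
    ∫ ω, φ (mix A Z a ω) ∂P = ∫ ω in A, φ (Z ω) ∂P + ∫ _ in Aᶜ, φ a ∂P := by
  classical
  have h := integrable_comp hφ (aemeasurable_mix hA hZ a) (integrable_dist_mix hA hZ hc a)
  rw [← integral_add_compl hA (f := fun ω => φ (mix A Z a ω)) h, mix_eq_piecewise]
  congr 1
  · exact setIntegral_congr_fun hA fun ω hω => by simp [hω]
  · exact setIntegral_congr_fun hA.compl fun ω hω => by
      rw [Set.piecewise_eq_of_notMem _ _ _ hω]

omit [CompleteSpace E] [TopologicalSpace.SeparableSpace X] in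
/-- A random convex point represented by a `G`-measurable integrable vector lies in `L¹(G)`. -/
theorem memL1_of_ae_eq [CompleteSpace X] [IsFiniteMeasure P] (hφ : IsAffineIsometry φ)
    {G : MeasurableSpace Ω} {W : Ω → E} (hW : StronglyMeasurable[G] W) (hWi : Integrable W P)
    {Y : Ω → X} (hY : ∀ᵐ ω ∂P, Y ω ∈ convexDomain X) (hYW : φ ∘ Y =ᵐ[P] W) {c : X}
    (hc : c ∈ convexDomain X) : MemL1 P G (convexDomain X) Y := by
  let : MeasurableSpace E := borel E
  have : BorelSpace E := ⟨rfl⟩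
  have : CompleteSpace (convexDomain X) := isClosed_convexDomain.completeSpace_coe
  have hiso : Isometry fun x : convexDomain X => φ x :=
    Isometry.of_dist_eq fun x y => hφ.dist_eq_of_mem x.2 y.2
  -- `r` is a Borel left inverse of `φ` on the convex domain, defined on all of `E`; thus `r ∘ W` is
  -- a `G`-measurable version of `Y`.
  obtain ⟨r, hr, hrφ⟩ := hiso.isClosedEmbedding.measurableEmbedding.exists_measurable_extend
    measurable_id (fun _ => ⟨⟨c, hc⟩⟩)
  have hYr : ∀ᵐ ω ∂P, Y ω = (r (W ω) : X) := by
    filter_upwards [hY, hYW] with ω h1 h2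
    rw [← h2]
    exact (congrArg Subtype.val (congrFun hrφ ⟨Y ω, h1⟩)).symm
  refine ⟨fun ω => (r (W ω) : X), (measurable_subtype_coe.comp hr).comp hW.measurable,
    fun ω => (r (W ω)).2, ⟨c, ?_⟩, hYr⟩
  refine ((integrable_const (φ c)).sub hWi).norm.congr ?_
  filter_upwards [hYr, hYW] with ω h1 h2
  rw [← hφ.dist_eq_of_mem hc (r (W ω)).2, ← h1, dist_eq_norm, Pi.sub_apply, ← h2,
    Function.comp_apply]

end Probability

end CCSpace

/-! ### The characterization of conditional expectation -/

theorem theorem4p9 {X : Type*} [MetricSpace X] [CompleteSpace X]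
    [TopologicalSpace.SeparableSpace X] [MeasurableSpace X] [BorelSpace X] [CCSpace X]
    {Ω : Type*} {mΩ : MeasurableSpace Ω} (P : Measure Ω) [IsProbabilityMeasure P]
    (G : MeasurableSpace Ω) (hG : G ≤ mΩ)
    (u : ℕ → X) (hu0 : u 0 ∈ CCSpace.convexDomain X) (hu : DenseRange (fun j => u (j + 1)))
    (Z : Ω → X) (hZ : CCSpace.MemL1 P mΩ Set.univ Z)
    (a : X) (ha : a ∈ CCSpace.convexDomain X) :
    (∃ Y : Ω → X, CCSpace.IsCondExp P G u Z Y) ∧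
    ∀ Y : Ω → X, CCSpace.IsCondExp P G u Z Y ↔
      (CCSpace.MemL1 P G (CCSpace.convexDomain X) Y ∧
        ∀ A : Set Ω, MeasurableSet[G] A → ∃ e : X,
          CCSpace.HasExp P u (CCSpace.mix A Z a) e ∧
          CCSpace.HasExp P u (CCSpace.mix A Y a) e) := by
  have : Nonempty X := ⟨u 0⟩
  have hd : DenseRange u := hu.mono (by rintro _ ⟨j, rfl⟩; exact ⟨j + 1, rfl⟩)
  obtain ⟨E, _, _, _, φ, h1, h2⟩ := CCSpace.exists_embedding X
  have hφ : CCSpace.IsAffineIsometry φ := ⟨h1, h2⟩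
  have hZm := hZ.aemeasurable le_rfl
  obtain ⟨c, hc⟩ := hZ.exists_integrable_dist
  have hφZ := CCSpace.integrable_comp hφ hZm hc
  refine ⟨CCSpace.exists_isCondExp hφ hG hd hZm hc, fun Y => ?_⟩
  rw [CCSpace.isCondExp_iff hφ hG hd hZm hc]
  constructor
  · rintro ⟨hY, hYW⟩
    have hY1 : CCSpace.MemL1 P G (CCSpace.convexDomain X) Y :=
      CCSpace.memL1_of_ae_eq hφ stronglyMeasurable_condExp integrable_condExp hY hYW hu0
    have hYm := hY1.aemeasurable hG
    obtain ⟨c', hc'⟩ := hY1.exists_integrable_dist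
    refine ⟨hY1, fun A hA => ?_⟩
    have hA' := hG A hA
    obtain ⟨e, he⟩ := CCSpace.exists_hasExp hφ hd (CCSpace.aemeasurable_mix hA' hZm a)
      (CCSpace.integrable_dist_mix hA' hZm hc a)
    refine ⟨e, he, ?_⟩
    rw [CCSpace.hasExp_iff hφ hd (CCSpace.aemeasurable_mix hA' hZm a)
      (CCSpace.integrable_dist_mix hA' hZm hc a), CCSpace.integral_mix hφ hA' hZm hc] at he
    rw [CCSpace.hasExp_iff hφ hd (CCSpace.aemeasurable_mix hA' hYm a)
      (CCSpace.integrable_dist_mix hA' hYm hc' a), CCSpace.integral_mix hφ hA' hYm hc']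
    -- The same `e` serves both: it is convex, and the integrals of `φ ∘ Z` and `φ ∘ Y` over `A`
    -- agree.
    refine ⟨he.1, he.2.trans ?_⟩
    congr 1
    exact (setIntegral_condExp hG hφZ hA).symm.trans
      (integral_congr_ae (ae_restrict_of_ae hYW.symm))
  · rintro ⟨hY1, hYA⟩
    have hYm := hY1.aemeasurable hG
    obtain ⟨c', hc'⟩ := hY1.exists_integrable_dist
    have hφY := CCSpace.integrable_comp hφ hYm hc'
    obtain ⟨Y', hY'm, hY'C, -, hYY'⟩ := hY1
    refine ⟨hYY'.mono fun ω hω => hω ▸ hY'C ω, ?_⟩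
    -- Uniqueness of the Bochner conditional expectation; `Y` itself is only a.e. equal to the
    -- `G`-measurable `Y'`, which supplies the measurability.
    refine ae_eq_condExp_of_forall_setIntegral_eq hG hφZ (fun _ _ _ => hφY.integrableOn)
      (fun A hA _ => ?_) ?_
    · have hA' := hG A hA
      obtain ⟨e, he, he'⟩ := hYA A hA
      rw [CCSpace.hasExp_iff hφ hd (CCSpace.aemeasurable_mix hA' hZm a)
        (CCSpace.integrable_dist_mix hA' hZm hc a), CCSpace.integral_mix hφ hA' hZm hc] at he
      rw [CCSpace.hasExp_iff hφ hd (CCSpace.aemeasurable_mix hA' hYm a)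
        (CCSpace.integrable_dist_mix hA' hYm hc' a), CCSpace.integral_mix hφ hA' hYm hc'] at he'
      exact add_right_cancel (he'.2.symm.trans he.2)
    · have := UniformSpace.secondCountable_of_separable X
      exact ⟨φ ∘ Y', hφ.continuous.comp_stronglyMeasurable hY'm.stronglyMeasurable,
        hYY'.mono fun ω hω => by simp only [Function.comp_apply, hω]⟩
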